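/- Let $\mathcal E$ be a finite-dimensional real inner product space, let $f:\mathcal E\to(-\infty,\infty]$ be convex and lower semicontinuous, with $\mathrm{dom}(f)=\{x: f(x)<\infty\}$ and $\mathrm{epi}(f)=\{(x,t)\in\mathcal E\times\mathbb R: f(x)\le t\}$. Let $S\subseteq\mathcal E$ be closed and convex, let $A$ be a linear map from $\mathcal E$ to a real vector space, let $b$ be a vector of that space, and put $\mathrm{Feas}=\{x\in S: Ax=b\}$. Let $\bar e\in\mathrm{int}(S\cap\mathrm{dom}(f))$ satisfy $A\bar e=b$, and assume that the set $\{x\in\mathrm{Feas}: f(x)\le f(\bar e)\}$ is bounded; denote its diameter by $\bar D$. Let $f^*=\inf_{x\in\mathrm{Feas}}f(x)$ (which is then finite), let $\hat f\in\mathbb R$ satisfy $\hat f>f(\bar e)$, and let $$\hat r=\sup\{r : \text{for all } x,\ \|x-\bar e\|\le r \text{ and } Ax=b \text{ imply } x\in S \text{ and } f(x)\le\hat f\}.$$ (If $\hat r=\infty$, then $\bar D=0$ and $\bar D/\hat r$ means $0$; if $\bar D/\hat r=0$, the right-hand side of the bound (1) below is read as $0$.) For $x\in\mathcal E$ and $t\in\mathbb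 R$ let $\alpha_1(x)=\sup\{a\in\mathbb R:\bar e+a(x-\bar e)\in S\}$, $\alpha_2(x,t)=\sup\{a\in\mathbb R: f(\bar e+a(x-\bar e))\le\hat f+a(t-\hat f)\}$, $\alpha(x,t)=\min\{\alpha_1(x),\alpha_2(x,t)\}$ (finite and positive if $Ax=b$ and $t<\hat f$), and $$\pi'(x,t)=(\bar e,\hat f)+\alpha(x,t)\,\big((x,t)-(\bar e,\hat f)\big).$$ Write $N_C(p)=\{v:\langle v,q-p\rangle\le0\ \forall q\in C\}$, where $\mathcal E\times\mathbb R$ carries the inner product $\langle x_1,x_2\rangle+t_1t_2$. Let $$G_1(x')=\Big\{\tfrac{-1}{\langle v,\bar e-x'\rangle}v: 0\ne v\in N_S(x')\Big\},\qquad G_2(x',t')=\Big\{\tfrac{-1}{\langle v,\bar e-x'\rangle+(\hat f-t')\delta}v: (0,0)\ne(v,\delta)\in N_{\mathrm{epi}(f)}(x',t')\Big\},$$ $\mathrm{bdy}_1=\{(x',t'): x'\in\mathrm{bdy}(S)\}$, $\mathrm{bdy}_2=\mathrm{bdy}(\mathrm{epi}(f))$, and let $G(x',t')$ be $G_1(x')$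 on $\mathrm{bdy}_1\setminus\mathrm{bdy}_2$, $G_2(x',t')$ on $\mathrm{bdy}_2\setminus\mathrm{bdy}_1$, and the convex hull of $G_1(x')\cup G_2(x',t')$ on $\mathrm{bdy}_1\cap\mathrm{bdy}_2$. Let $P$ be the orthogonal projection of $\mathcal E$ onto $\ker A$. Algorithm B, given $f^*$, $\bar e$ and $\hat f$, starts with $x_0=\bar e$, $(x_0',t_0')=(\bar e,f(\bar e))$, $\alpha_0=\alpha(x_0,f^*)$ and iterates, for $k=0,1,2,\dots$: choose any $g_k\in G(x_k',t_k')$ and let $$x_{k+1}=x_k+\frac{\alpha_k-1}{\alpha_k\|P(g_k)\|^2}P(g_k),\qquad (x_{k+1}',t_{k+1}')=\pi'(x_{k+1},f^*),\qquad \alpha_{k+1}=\alpha(x_{k+1},f^*),$$ where $x_{k+1}=x_k$ if $P(g_k)=0$ (which can happen only if $\alpha_k=1$). Then for every such sequence all points $x_k'$ lie in $\mathrm{Feas}\cap\mathrm{dom}(f)$, and for all $0<\epsilon<1$ and all integers $\ell\ge0$, $$\ell\ \ge\ 4\Big(\frac{\bar D}{\hat r}\Big)^2\Big(\frac43\Big(\frac{1-\epsilon}{\epsilon}\Big)^2+4\,\frac{1-\epsilon}{\epsilon}+\log_2\frac{1-\epsilon}{\epsilon}+\log_2\frac{\bar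 D}{\hat r}+1\Big)\tag{1}$$ implies $$\min_{0\le k\le\ell}\frac{f(x_k')-f^*}{\hat f-f^*}\ \le\ \epsilon .$$ -/

import Mathlib

open scoped RealInnerProductSpace

noncomputable section

namespace AlgorithmB

variable {E : Type*} [NormedAddCommGroup E] [InnerProductSpace ℝ E] [FiniteDimensional ℝ E]
variable {F : Type*} [AddCommGroup F] [Module ℝ F]

/-- Effective domain of an extended-valued function `f : E → (-∞, ∞]`. -/
def dom (f : E → EReal) : Set E := {x | f x ≠ ⊤}

/-- Epigraph `{(x, t) | f x ≤ t}`; here `t` is real, so `x ∈ dom f` is automatic. -/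
def epi (f : E → EReal) : Set (E × ℝ) := {p | f p.1 ≤ (p.2 : EReal)}

/-- Feasible region `{x ∈ S | A x = b}`. -/
def feas (S : Set E) (A : E →ₗ[ℝ] F) (b : F) : Set E := {x | x ∈ S ∧ A x = b}

/-- The sublevel set `{x ∈ Feas | f x ≤ f ē}`. -/
def sublevel (f : E → EReal) (S : Set E) (A : E →ₗ[ℝ] F) (b : F) (ebar : E) : Set E :=
  {x | x ∈ feas S A b ∧ f x ≤ f ebar}

/-- The diameter `D̄` of the sublevel set. -/
def Dbar (f : E → EReal) (S : Set E) (A : E →ₗ[ℝ] F) (b : F) (ebar : E) : ℝ :=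
  Metric.diam (sublevel f S A b ebar)

/-- The optimal value `f*`, i.e. the infimum of `f` over the feasible region, as a real number
(the infimum is finite under the hypotheses of the theorem). -/
def fstar (f : E → EReal) (S : Set E) (A : E →ₗ[ℝ] F) (b : F) : ℝ :=
  (⨅ x ∈ feas S A b, f x).toReal

/-- `r̂ = sup {r | ‖x - ē‖ ≤ r and A x = b imply x ∈ S and f x ≤ f̂}`.
When the sublevel set is bounded, this set of radii is unbounded only if `ker A = 0`; the only
point with `A x = b` is then `ē`, so `D̄ = 0` and the quotient `D̄ / r̂` is `0` either way. -/
def rhat (f : E → EReal) (S : Set E) (A : E →ₗ[ℝ] F) (b : F) (ebar : E) (fhat : ℝ) : ℝ :=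
  sSup {r : ℝ | ∀ x : E, ‖x - ebar‖ ≤ r → A x = b → x ∈ S ∧ f x ≤ (fhat : EReal)}

/-- `x(a) = ē + a (x - ē)`. -/
def lineX (ebar x : E) (a : ℝ) : E := ebar + a • (x - ebar)

/-- `t(a) = f̂ + a (t - f̂)`. -/
def lineT (fhat t : ℝ) (a : ℝ) : ℝ := fhat + a * (t - fhat)

/-- `α₁(x) = sup {a | x(a) ∈ S}`, possibly `∞`. -/
def alpha1 (S : Set E) (ebar x : E) : EReal :=
  sSup ((fun a : ℝ => (a : EReal)) '' {a : ℝ | lineX ebar x a ∈ S})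

/-- `α₂(x, t) = sup {a | f(x(a)) ≤ t(a)}`, possibly `∞`. -/
def alpha2 (f : E → EReal) (ebar : E) (fhat : ℝ) (x : E) (t : ℝ) : EReal :=
  sSup ((fun a : ℝ => (a : EReal)) ''
    {a : ℝ | f (lineX ebar x a) ≤ (lineT fhat t a : EReal)})

/-- `α(x, t) = min {α₁(x), α₂(x, t)}`, which is finite and positive when `A x = b`, `t < f̂`. -/
def alpha (f : E → EReal) (S : Set E) (ebar : E) (fhat : ℝ) (x : E) (t : ℝ) : ℝ :=
  (min (alpha1 S ebar x) (alpha2 f ebar fhat x t)).toReal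

/-- `π'(x, t) = (ē, f̂) + α(x, t) ((x, t) - (ē, f̂))`. -/
def radialProj (f : E → EReal) (S : Set E) (ebar : E) (fhat : ℝ) (x : E) (t : ℝ) : E × ℝ :=
  (ebar, fhat) + alpha f S ebar fhat x t • ((x, t) - (ebar, fhat))

/-- Normal cone to `S` at `x'`. -/
def normalCone (S : Set E) (x' : E) : Set E :=
  {v | ∀ x ∈ S, ⟪v, x - x'⟫ ≤ 0}

/-- Normal cone to a subset of `E × ℝ` at `p'`, with respect to the inner product
`⟨x₁, x₂⟩ + t₁ t₂`. -/
def normalConeProd (C : Set (E × ℝ)) (p' : E × ℝ) : Set (E × ℝ) :=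
  {w | ∀ p ∈ C, ⟪w.1, p.1 - p'.1⟫ + w.2 * (p.2 - p'.2) ≤ 0}

/-- `G₁(x') = {(-1 / ⟨v, ē - x'⟩) v | 0 ≠ v ∈ N_S(x')}`. -/
def G1 (S : Set E) (ebar x' : E) : Set E :=
  {g | ∃ v ∈ normalCone S x', v ≠ 0 ∧ g = (-1 / ⟪v, ebar - x'⟫) • v}

/-- `G₂(x', t') = {(-1 / (⟨v, ē - x'⟩ + (f̂ - t') δ)) v | 0 ≠ (v, δ) ∈ N_{epi f}(x', t')}`. -/
def G2 (f : E → EReal) (ebar : E) (fhat : ℝ) (p' : E × ℝ) : Set E :=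
  {g | ∃ w ∈ normalConeProd (epi f) p', w ≠ 0 ∧
    g = (-1 / (⟪w.1, ebar - p'.1⟫ + (fhat - p'.2) * w.2)) • w.1}

/-- `bdy₁ = {(x', t') | x' ∈ bdy S}`. -/
def bdy1 (S : Set E) : Set (E × ℝ) := {p' | p'.1 ∈ frontier S}

/-- `bdy₂ = bdy (epi f)`. -/
def bdy2 (f : E → EReal) : Set (E × ℝ) := frontier (epi f)

open Classical in
/-- The set `G(x', t')` for `(x', t') ∈ bdy₁ ∪ bdy₂` (and the empty set elsewhere). -/
def G (f : E → EReal) (S : Set E) (ebar : E) (fhat : ℝ) (p' : E × ℝ) : Set E :=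
  if p' ∈ bdy1 S \ bdy2 f then G1 S ebar p'.1
  else if p' ∈ bdy2 f \ bdy1 S then G2 f ebar fhat p'
  else if p' ∈ bdy1 S ∩ bdy2 f then convexHull ℝ (G1 S ebar p'.1 ∪ G2 f ebar fhat p')
  else ∅

/-- Orthogonal projection onto the kernel of `A`. -/
def P (A : E →ₗ[ℝ] F) (g : E) : E := (LinearMap.ker A).starProjection g

/-- `x`, `(x', t')`, `α` and `g` are sequences generated by Algorithm B, where `g k` is the element
of `G(x'_k, t'_k)` chosen (arbitrarily) in iteration `k`. -/
structure IsRun (f : E → EReal) (S : Set E) (A : E →ₗ[ℝ] F) (b : F) (ebar : E) (fhat : ℝ)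
    (x x' : ℕ → E) (t' α : ℕ → ℝ) (g : ℕ → E) : Prop where
  init_x : x 0 = ebar
  init_proj : x' 0 = ebar ∧ t' 0 = (f ebar).toReal
  init_alpha : α 0 = alpha f S ebar fhat (x 0) (fstar f S A b)
  choose_g : ∀ k, g k ∈ G f S ebar fhat (x' k, t' k)
  step_x : ∀ k, x (k + 1) = x k + ((α k - 1) / (α k * ‖P A (g k)‖ ^ 2)) • P A (g k)
  step_proj : ∀ k,
    (x' (k + 1), t' (k + 1)) = radialProj f S ebar fhat (x (k + 1)) (fstar f S A b)
  step_alpha : ∀ k, α (k + 1) = alpha f S ebar fhat (x (k + 1)) (fstar f S A b)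

end AlgorithmB

end

open scoped RealInnerProductSpace Topology

namespace AlgorithmB

open Set Filter

variable {E : Type*} [NormedAddCommGroup E] [InnerProductSpace ℝ E]
variable {F : Type*} [AddCommGroup F] [Module ℝ F]

/-! The iteration is a subgradient method with Polyak's step size, seen radially from (ē, f̂). Each
g in G extends to a functional (g, δ) that, relative to (ē, f̂), is at most 1 on epi f over S and
equals 1 at (x', t') (`exists_support_of_mem_G`). By homogeneity it equals 1/α at (x, f*), while at
a minimizer (z, f*) it is at most 1; hence ⟨g, x - z⟩ ≥ d := 1/α - 1. The feasible ball of radius r̂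
at height f̂ gives r̂‖P g‖ ≤ 1. So each step decreases ‖x - z‖² by at least (r̂ d)²
(`norm_polyak_step_sq_le`).

The relative gap is at most 1 - α, so while it exceeds ε, d ≥ ε/(1 - ε). Summing the decreases from
‖ē - z‖² ≤ D̄² bounds the number of such steps by (D̄/r̂)²((1 - ε)/ε)², which the stated bound
dominates. -/

/-! ### Epigraphs and continuity of convex functions -/

lemma isClosed_epi {X : Type*} [TopologicalSpace X] {f : X → EReal} (hf : LowerSemicontinuous f) : IsClosed (epi f) := by
  have h := hf.isClosed_epigraph
  exact h.preimage (f := fun p : X × ℝ => (p.1, (p.2 : EReal)))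
    (continuous_fst.prodMk (continuous_coe_real_ereal.comp continuous_snd))

lemma mem_dom_of_le_coe {X : Type*} {f : X → EReal} {x : X} {t : ℝ} (h : f x ≤ t) : x ∈ dom f :=
  (h.trans_lt (EReal.coe_lt_top t)).ne

lemma convexOn_toReal {f : E → EReal} (hf_bot : ∀ x, f x ≠ ⊥) (hf_conv : Convex ℝ (epi f)) :
    ConvexOn ℝ (dom f) (fun x => (f x).toReal) := by
  have key : ∀ x ∈ dom f, ∀ y ∈ dom f, ∀ a c : ℝ, 0 ≤ a → 0 ≤ c → a + c = 1 →
      f (a • x + c • y) ≤ ((a * (f x).toReal + c * (f y).toReal : ℝ) : EReal) := by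
    intro x hx y hy a c ha hc hac
    have hx' : (x, (f x).toReal) ∈ epi f := EReal.le_coe_toReal hx
    have hy' : (y, (f y).toReal) ∈ epi f := EReal.le_coe_toReal hy
    exact hf_conv hx' hy' ha hc hac
  refine ⟨fun x hx y hy a c ha hc hac => mem_dom_of_le_coe (key x hx y hy a c ha hc hac), ?_⟩
  intro x hx y hy a c ha hc hac
  have h := EReal.toReal_le_toReal (key x hx y hy a c ha hc hac) (hf_bot _)
    (EReal.coe_ne_top _)
  rwa [EReal.toReal_coe] at h

/-- A convex function is upper semicontinuous at interior points of its domain. -/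
lemma eventually_lt_of_mem_interior_dom [FiniteDimensional ℝ E] {f : E → EReal}
    (hf_bot : ∀ x, f x ≠ ⊥) (hf_conv : Convex ℝ (epi f)) {e : E} (he : e ∈ interior (dom f))
    {c : ℝ} (hc : f e < c) : ∀ᶠ x in 𝓝 e, f x < c := by
  have hcont : ContinuousAt (fun x => (f x).toReal) e :=
    (convexOn_toReal hf_bot hf_conv).continuousOn_interior.continuousAt
      (isOpen_interior.mem_nhds he)
  have hlt : (f e).toReal < c := by
    rw [← EReal.coe_lt_coe_iff, EReal.coe_toReal (interior_subset he) (hf_bot e)]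
    exact hc
  filter_upwards [hcont.eventually (gt_mem_nhds hlt), isOpen_interior.mem_nhds he] with x hx hxd
  rw [← EReal.coe_toReal (interior_subset hxd) (hf_bot x)]
  exact EReal.coe_lt_coe_iff.2 hx

lemma mem_interior_epi [FiniteDimensional ℝ E] {f : E → EReal}
    (hf_bot : ∀ x, f x ≠ ⊥) (hf_conv : Convex ℝ (epi f)) {e : E} (he : e ∈ interior (dom f))
    {c : ℝ} (hc : f e < c) : (e, c) ∈ interior (epi f) := by
  obtain ⟨d, hd, hdc⟩ := EReal.lt_iff_exists_real_btwn.1 hc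
  rw [mem_interior_iff_mem_nhds, nhds_prod_eq]
  filter_upwards [(eventually_lt_of_mem_interior_dom hf_bot hf_conv he hd).prod_mk
    (lt_mem_nhds (EReal.coe_lt_coe_iff.1 hdc))] with p hp
  exact hp.1.le.trans (EReal.coe_le_coe_iff.2 hp.2.le)

/-! ### Existence of a minimizer -/

/-- The infimum `f*` is attained on the feasible region. -/
lemma exists_minimizer [FiniteDimensional ℝ E] {f : E → EReal} (hf_bot : ∀ x, f x ≠ ⊥)
    (hf_lsc : LowerSemicontinuous f) {S : Set E} (hS_closed : IsClosed S) {A : E →ₗ[ℝ] F}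
    {b : F} {ebar : E} (heS : ebar ∈ S) (hed : ebar ∈ dom f) (hA : A ebar = b)
    (hbdd : Bornology.IsBounded (sublevel f S A b ebar)) :
    ∃ z ∈ sublevel f S A b ebar, f z = fstar f S A b ∧
      ∀ y ∈ feas S A b, (fstar f S A b : EReal) ≤ f y := by
  have hne : ebar ∈ sublevel f S A b ebar := ⟨⟨heS, hA⟩, le_rfl⟩
  -- `F` has no topology; closedness comes from the finite-dimensional subspace `ker A`, translated
  -- by ē.
  have hAc : IsClosed {x : E | A x = b} := by
    have h : {x : E | A x = b} = (fun x => x - ebar) ⁻¹' (LinearMap.ker A : Set E) := by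
      ext x
      simp [sub_eq_zero, hA]
    rw [h]
    exact (LinearMap.ker A).closed_of_finiteDimensional.preimage
      (continuous_id.sub continuous_const)
  have hclosed : IsClosed (sublevel f S A b ebar) :=
    (hS_closed.inter hAc).inter (hf_lsc.isClosed_preimage (f ebar))
  obtain ⟨z, hz, hmin⟩ := (hf_lsc.lowerSemicontinuousOn _).exists_isMinOn ⟨ebar, hne⟩
    (Metric.isCompact_of_isClosed_isBounded hclosed hbdd)
  have hmin' : ∀ y ∈ feas S A b, f z ≤ f y := by
    intro y hy
    rcases le_total (f y) (f ebar) with h | h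
    · exact hmin ⟨hy, h⟩
    · exact hz.2.trans h
  have hfs : f z = fstar f S A b := by
    have h : (⨅ x ∈ feas S A b, f x) = f z :=
      le_antisymm (iInf₂_le z hz.1) (le_iInf₂ hmin')
    rw [fstar, h, EReal.coe_toReal (hz.2.trans_lt (lt_top_iff_ne_top.2 hed)).ne (hf_bot z)]
  exact ⟨z, hz, hfs, fun y hy => hfs ▸ hmin' y hy⟩

/-! ### Radial projection from (ē, f̂) -/

lemma lineX_mem {S : Set E} (hS : Convex ℝ S) {ebar x : E} (he : ebar ∈ S) {a c : ℝ}
    (ha : 0 ≤ a) (hac : a ≤ c) (hc : lineX ebar x c ∈ S) : lineX ebar x a ∈ S := by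
  rcases ha.eq_or_lt with rfl | ha
  · simpa [lineX] using he
  have hc0 : 0 < c := ha.trans_le hac
  have h := hS.add_smul_sub_mem he hc (t := a / c) ⟨by positivity, (div_le_one hc0).2 hac⟩
  simpa [lineX, smul_smul, div_mul_cancel₀ _ hc0.ne'] using h

lemma line_mem_epi {f : E → EReal} (hf : Convex ℝ (epi f)) {ebar x : E} {fhat t : ℝ}
    (he : f ebar ≤ fhat) {a c : ℝ} (ha : 0 ≤ a) (hac : a ≤ c)
    (hc : f (lineX ebar x c) ≤ lineT fhat t c) : f (lineX ebar x a) ≤ lineT fhat t a := by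
  rcases ha.eq_or_lt with rfl | ha
  · simpa [lineX, lineT] using he
  have hc0 : 0 < c := ha.trans_le hac
  have he' : (ebar, fhat) ∈ epi f := he
  have hc' : (lineX ebar x c, lineT fhat t c) ∈ epi f := hc
  have h := hf.add_smul_sub_mem he' hc' (t := a / c) ⟨by positivity, (div_le_one hc0).2 hac⟩
  have h2 : a / c * (c * (t - fhat)) = a * (t - fhat) := by field_simp
  simpa [epi, lineX, lineT, smul_smul, div_mul_cancel₀ _ hc0.ne', h2] using h

/-- The basic properties of `α(x, f*)` for `A x = b`: it lies in `(0, 1]`, the point `π'(x, f*)`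
belongs to `epi f` with first component in `S`, and `α` is the largest such parameter. -/
lemma alpha_spec {f : E → EReal} (hf_lsc : LowerSemicontinuous f) (hf_conv : Convex ℝ (epi f))
    {S : Set E} (hS_closed : IsClosed S) (hS_conv : Convex ℝ S) {A : E →ₗ[ℝ] F} {b : F}
    {ebar : E} (he : ebar ∈ interior S) (hA : A ebar = b) {fhat fs : ℝ}
    (hep : (ebar, fhat) ∈ interior (epi f)) (hfs : ∀ y ∈ feas S A b, (fs : EReal) ≤ f y)
    (hlt : fs < fhat) {x : E} (hx : A x = b) :
    0 < alpha f S ebar fhat x fs ∧ alpha f S ebar fhat x fs ≤ 1 ∧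
      lineX ebar x (alpha f S ebar fhat x fs) ∈ S ∧
      f (lineX ebar x (alpha f S ebar fhat x fs)) ≤
        lineT fhat fs (alpha f S ebar fhat x fs) ∧
      ∀ a : ℝ, lineX ebar x a ∈ S → f (lineX ebar x a) ≤ lineT fhat fs a →
        a ≤ alpha f S ebar fhat x fs := by
  set m : EReal := min (alpha1 S ebar x) (alpha2 f ebar fhat x fs) with hm
  have hα : alpha f S ebar fhat x fs = m.toReal := rfl
  have hcX : Continuous (lineX ebar x) := by unfold lineX; fun_prop
  have hcT : Continuous (lineT fhat fs) := by unfold lineT; fun_prop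
  have h0X : lineX ebar x 0 = ebar := by simp [lineX]
  have h0T : lineT fhat fs 0 = fhat := by simp [lineT]
  have hmax : ∀ a : ℝ, lineX ebar x a ∈ S → f (lineX ebar x a) ≤ lineT fhat fs a →
      (a : EReal) ≤ m := fun a h1 h2 => le_min (le_sSup ⟨a, h1, rfl⟩) (le_sSup ⟨a, h2, rfl⟩)
  have hbelow : ∀ a : ℝ, 0 ≤ a → (a : EReal) < m →
      lineX ebar x a ∈ S ∧ f (lineX ebar x a) ≤ lineT fhat fs a := by
    intro a ha ham
    obtain ⟨_, ⟨c, hc, rfl⟩, hac⟩ := lt_sSup_iff.1 (lt_min_iff.1 ham).1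
    obtain ⟨_, ⟨d, hd, rfl⟩, had⟩ := lt_sSup_iff.1 (lt_min_iff.1 ham).2
    exact ⟨lineX_mem hS_conv (interior_subset he) ha (EReal.coe_le_coe_iff.1 hac.le) hc,
      line_mem_epi hf_conv (interior_subset hep : (ebar, fhat) ∈ epi f) ha
        (EReal.coe_le_coe_iff.1 had.le) hd⟩
  have hpos : 0 < m := by
    have h1 : ∀ᶠ a in 𝓝 (0 : ℝ), lineX ebar x a ∈ S :=
      hcX.continuousAt.preimage_mem_nhds (by rw [h0X]; exact mem_interior_iff_mem_nhds.1 he)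
    have h2 : ∀ᶠ a in 𝓝 (0 : ℝ), (lineX ebar x a, lineT fhat fs a) ∈ epi f :=
      (hcX.prodMk hcT).continuousAt.preimage_mem_nhds
        (by rw [h0X, h0T]; exact mem_interior_iff_mem_nhds.1 hep)
    obtain ⟨a, ⟨ha1, ha2⟩, ha⟩ :=
      (((h1.and h2).filter_mono nhdsWithin_le_nhds).and
        (self_mem_nhdsWithin (s := Ioi (0 : ℝ)))).exists
    exact lt_of_lt_of_le (by exact_mod_cast ha) (hmax a ha1 ha2)
  -- A parameter c > 1 would yield a feasible point of value at most t(c) < f*.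
  have hle : m ≤ 1 := by
    by_contra! h
    obtain ⟨c, hc1, hcm⟩ := EReal.lt_iff_exists_real_btwn.1 h
    have hc1 : 1 < c := by exact_mod_cast hc1
    obtain ⟨h1, h2⟩ := hbelow c (by linarith) hcm
    have h3 : A (lineX ebar x c) = b := by simp [lineX, hx, hA]
    have h4 : fs ≤ lineT fhat fs c := EReal.coe_le_coe_iff.1 ((hfs _ ⟨h1, h3⟩).trans h2)
    unfold lineT at h4
    nlinarith
  have hmr : ((m.toReal : ℝ) : EReal) = m :=
    EReal.coe_toReal (hle.trans_lt (by exact_mod_cast EReal.coe_lt_top 1)).ne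
      (bot_le.trans_lt hpos).ne'
  rw [hα]
  have hpos' : 0 < m.toReal := by rw [← EReal.coe_lt_coe_iff, hmr]; exact_mod_cast hpos
  -- Closedness of S and epi f carries membership from [0, α) to α itself.
  have hclosure : m.toReal ∈ closure (Ico 0 m.toReal) := by
    rw [closure_Ico hpos'.ne]
    exact right_mem_Icc.2 hpos'.le
  have hIco : ∀ a ∈ Ico 0 m.toReal,
      lineX ebar x a ∈ S ∧ (lineX ebar x a, lineT fhat fs a) ∈ epi f := fun a ha =>
    hbelow a ha.1 (by rw [← hmr]; exact EReal.coe_lt_coe_iff.2 ha.2)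
  refine ⟨hpos', by rw [← EReal.coe_le_coe_iff, hmr]; exact_mod_cast hle, ?_, ?_, ?_⟩
  · exact closure_minimal (fun a ha => (hIco a ha).1) (hS_closed.preimage hcX) hclosure
  · exact closure_minimal (fun a ha => (hIco a ha).2)
      ((isClosed_epi hf_lsc).preimage (hcX.prodMk hcT)) hclosure
  · intro a h1 h2
    rw [← EReal.coe_le_coe_iff, hmr]
    exact hmax a h1 h2

/-! ### Normal cones and supporting functionals -/

/-- Testing the normal at ē + ηv, still in S for small η > 0, makes the inequality strict by η‖v‖².
Thus the denominator in `G1` is negative. -/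
lemma normalCone_inner_neg {S : Set E} {ebar x' v : E} (he : ebar ∈ interior S)
    (hv : v ∈ normalCone S x') (hv0 : v ≠ 0) : ⟪v, ebar - x'⟫ < 0 := by
  have hc : Continuous fun η : ℝ => ebar + η • v := by fun_prop
  have h1 : ∀ᶠ η in 𝓝 (0 : ℝ), ebar + η • v ∈ S :=
    hc.continuousAt.preimage_mem_nhds (by simpa using mem_interior_iff_mem_nhds.1 he)
  obtain ⟨η, hη1, hη⟩ := ((h1.filter_mono nhdsWithin_le_nhds).and
    (self_mem_nhdsWithin (s := Ioi (0 : ℝ)))).exists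
  have hη : 0 < η := hη
  have h := hv _ hη1
  rw [add_sub_right_comm, inner_add_right, inner_smul_right, real_inner_self_eq_norm_sq] at h
  have : 0 < η * ‖v‖ ^ 2 := by positivity
  linarith

lemma normalConeProd_inner_neg {C : Set (E × ℝ)} {p p' w : E × ℝ} (he : p ∈ interior C)
    (hw : w ∈ normalConeProd C p') (hw0 : w ≠ 0) :
    ⟪w.1, p.1 - p'.1⟫ + (p.2 - p'.2) * w.2 < 0 := by
  have hc : Continuous fun η : ℝ => p + η • w := by fun_prop
  have h1 : ∀ᶠ η in 𝓝 (0 : ℝ), p + η • w ∈ C :=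
    hc.continuousAt.preimage_mem_nhds (by simpa using mem_interior_iff_mem_nhds.1 he)
  obtain ⟨η, hη1, hη⟩ := ((h1.filter_mono nhdsWithin_le_nhds).and
    (self_mem_nhdsWithin (s := Ioi (0 : ℝ)))).exists
  have hη : 0 < η := hη
  have h := hw _ hη1
  simp only [Prod.fst_add, Prod.snd_add, Prod.smul_fst, Prod.smul_snd, smul_eq_mul] at h
  rw [add_sub_right_comm, inner_add_right, inner_smul_right, real_inner_self_eq_norm_sq] at h
  have hpos : 0 < ‖w.1‖ ^ 2 + w.2 ^ 2 := by
    by_cases h1 : w.1 = 0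
    · have h2 : w.2 ≠ 0 := fun h2 => hw0 (Prod.ext h1 h2)
      positivity
    · have := norm_pos_iff.2 h1
      positivity
  have := mul_pos hη hpos
  nlinarith

/-- Each element of `G(x', t')` is the first component of a functional that supports
`{(x, t) ∈ epi f | x ∈ S}` at `(x', t')`, normalized to be `1` on `(x', t') - (ē, f̂)`. -/
lemma exists_support_of_mem_G {f : E → EReal} {S : Set E} {ebar : E} {fhat : ℝ}
    (he : ebar ∈ interior S) (hep : (ebar, fhat) ∈ interior (epi f)) {p' : E × ℝ} {g : E}
    (hg : g ∈ G f S ebar fhat p') :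
    ∃ δ : ℝ, (∀ y ∈ S, ∀ t : ℝ, f y ≤ t → ⟪g, y - ebar⟫ + δ * (t - fhat) ≤ 1) ∧
      ⟪g, p'.1 - ebar⟫ + δ * (p'.2 - fhat) = 1 := by
  -- `T` is convex because δ averages along with g; the convex hull in `G` then needs only `G1` and
  -- `G2` inside `T`.
  set T : Set E := {g | ∃ δ : ℝ,
    (∀ y ∈ S, ∀ t : ℝ, f y ≤ t → ⟪g, y - ebar⟫ + δ * (t - fhat) ≤ 1) ∧
      ⟪g, p'.1 - ebar⟫ + δ * (p'.2 - fhat) = 1} with hT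
  have hTconv : Convex ℝ T := by
    rintro g₁ ⟨δ₁, h₁, k₁⟩ g₂ ⟨δ₂, h₂, k₂⟩ a c ha hc hac
    refine ⟨a * δ₁ + c * δ₂, fun y hy t ht => ?_, ?_⟩
    · have e₁ := mul_le_mul_of_nonneg_left (h₁ y hy t ht) ha
      have e₂ := mul_le_mul_of_nonneg_left (h₂ y hy t ht) hc
      rw [inner_add_left, real_inner_smul_left, real_inner_smul_left]
      linarith
    · rw [inner_add_left, real_inner_smul_left, real_inner_smul_left]
      linear_combination a * k₁ + c * k₂ + hac
  have h1 : G1 S ebar p'.1 ⊆ T := by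
    rintro _ ⟨v, hv, hv0, rfl⟩
    have hneg := normalCone_inner_neg he hv hv0
    have e : ∀ y : E, ⟪v, y - ebar⟫ = ⟪v, y - p'.1⟫ - ⟪v, ebar - p'.1⟫ := fun y => by
      rw [← inner_sub_right, sub_sub_sub_cancel_right]
    refine ⟨0, fun y hy t _ => ?_, ?_⟩
    · rw [real_inner_smul_left, e, zero_mul, add_zero, div_mul_eq_mul_div, div_le_iff_of_neg hneg]
      linarith [hv y hy]
    · rw [real_inner_smul_left, e, sub_self, inner_zero_right]
      field_simp [hneg.ne]
      ring
  have h2 : G2 f ebar fhat p' ⊆ T := by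
    rintro _ ⟨w, hw, hw0, rfl⟩
    have hneg := normalConeProd_inner_neg hep hw hw0
    simp only at hneg
    have e : ∀ y : E, ⟪w.1, y - ebar⟫ = ⟪w.1, y - p'.1⟫ - ⟪w.1, ebar - p'.1⟫ := fun y => by
      rw [← inner_sub_right, sub_sub_sub_cancel_right]
    set d := ⟪w.1, ebar - p'.1⟫ + (fhat - p'.2) * w.2 with hd
    refine ⟨-1 / d * w.2, fun y hy t ht => ?_, ?_⟩
    · have hn := hw (y, t) ht
      simp only at hn
      rw [real_inner_smul_left, e, mul_assoc, ← mul_add, div_mul_eq_mul_div,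
        div_le_iff_of_neg hneg]
      linarith
    · rw [real_inner_smul_left, e, sub_self, inner_zero_right, mul_assoc, ← mul_add,
        div_mul_eq_mul_div, div_eq_iff hneg.ne]
      linarith
  change g ∈ T
  unfold G at hg
  split_ifs at hg with c1 c2 c3
  · exact h1 hg
  · exact h2 hg
  · exact convexHull_min (union_subset h1 h2) hTconv hg
  · exact hg.elim

/-! ### Projection onto ker A and the Polyak step -/

section Projection

variable [FiniteDimensional ℝ E]

lemma map_P (A : E →ₗ[ℝ] F) (g : E) : A (P A g) = 0 :=
  LinearMap.mem_ker.1 ((LinearMap.ker A).starProjection_apply_mem g)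

lemma inner_P_of_map_eq_zero (A : E →ₗ[ℝ] F) (g : E) {u : E} (hu : A u = 0) :
    ⟪P A g, u⟫ = ⟪g, u⟫ := by
  rw [P, Submodule.inner_starProjection_left_eq_right,
    Submodule.starProjection_eq_self_iff.2 (LinearMap.mem_ker.2 hu)]

/-- If `⟨g, u⟩ ≤ 1` on the ball of radius `r` in `ker A`, then `r ‖P g‖ ≤ 1`. -/
lemma mul_norm_P_le_one (A : E →ₗ[ℝ] F) (g : E) {r : ℝ} (hr : 0 ≤ r)
    (h : ∀ u : E, ‖u‖ ≤ r → A u = 0 → ⟪g, u⟫ ≤ 1) : r * ‖P A g‖ ≤ 1 := by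
  by_cases hn : P A g = 0
  · simp [hn]
  have hn' : 0 < ‖P A g‖ := norm_pos_iff.2 hn
  have h1 := h ((r / ‖P A g‖) • P A g)
    (by rw [norm_smul, Real.norm_of_nonneg (by positivity), div_mul_cancel₀ _ hn'.ne'])
    (by rw [map_smul, map_P, smul_zero])
  rw [inner_smul_right, ← inner_P_of_map_eq_zero A g (map_P A g),
    real_inner_self_eq_norm_sq] at h1
  calc r * ‖P A g‖ = r / ‖P A g‖ * ‖P A g‖ ^ 2 := by field_simp
    _ ≤ 1 := h1

end Projection

/-- One step of the subgradient method with Polyak's step size. -/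
lemma norm_polyak_step_sq_le {u q : E} {d r : ℝ} (hd : 0 ≤ d) (hr : 0 ≤ r)
    (hq : r * ‖q‖ ≤ 1) (hu : d ≤ ⟪q, u⟫) :
    ‖u + (-d / ‖q‖ ^ 2) • q‖ ^ 2 + (r * d) ^ 2 ≤ ‖u‖ ^ 2 := by
  -- Division by zero makes the step vanish here, as in the algorithm's convention, and `hu` forces
  -- d = 0.
  by_cases h0 : q = 0
  · subst h0
    have : d = 0 := le_antisymm (by simpa using hu) hd
    simp [this]
  have hn : 0 < ‖q‖ := norm_pos_iff.2 h0
  rw [norm_add_sq_real, inner_smul_right, real_inner_comm, norm_smul, mul_pow,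
    Real.norm_eq_abs, sq_abs]
  have h1 : (r * d) ^ 2 ≤ d ^ 2 / ‖q‖ ^ 2 := by
    rw [le_div_iff₀ (by positivity)]
    have : (r * ‖q‖) ^ 2 ≤ 1 := pow_le_one₀ (by positivity) hq
    nlinarith [sq_nonneg d]
  have h2 : -d / ‖q‖ ^ 2 * ⟪q, u⟫ ≤ -d / ‖q‖ ^ 2 * d :=
    mul_le_mul_of_nonpos_left hu (div_nonpos_of_nonpos_of_nonneg (by linarith) (by positivity))
  have h3 : -d / ‖q‖ ^ 2 * d = -(d ^ 2 / ‖q‖ ^ 2) := by ring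
  have h4 : (-d / ‖q‖ ^ 2) ^ 2 * ‖q‖ ^ 2 = d ^ 2 / ‖q‖ ^ 2 := by field_simp
  linarith

/-! ### Invariants of a run -/

section Run

variable [FiniteDimensional ℝ E]

/-- The invariants of a run: the iterates stay in `{A x = b}`, `α k ∈ (0, 1]`, and
`(x' k, t' k) = π'(x k, f*)` lies in `epi f` with `x' k ∈ S`. -/
lemma IsRun.invariants {f : E → EReal} (hf_bot : ∀ x, f x ≠ ⊥) (hf_lsc : LowerSemicontinuous f)
    (hf_conv : Convex ℝ (epi f)) {S : Set E} (hS_closed : IsClosed S) (hS_conv : Convex ℝ S)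
    {A : E →ₗ[ℝ] F} {b : F} {ebar : E} (he : ebar ∈ interior S) (hA : A ebar = b) {fhat : ℝ}
    (hep : (ebar, fhat) ∈ interior (epi f))
    (hfs : ∀ y ∈ feas S A b, (fstar f S A b : EReal) ≤ f y) (hlt : fstar f S A b < fhat)
    {x x' : ℕ → E} {t' α : ℕ → ℝ} {g : ℕ → E} (hrun : IsRun f S A b ebar fhat x x' t' α g)
    (k : ℕ) :
    A (x k) = b ∧ 0 < α k ∧ α k ≤ 1 ∧ x' k ∈ S ∧ f (x' k) ≤ t' k ∧
      x' k = lineX ebar (x k) (α k) ∧ t' k = lineT fhat (fstar f S A b) (α k) := by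
  have hAx : ∀ k, A (x k) = b := by
    intro k
    induction k with
    | zero => rw [hrun.init_x, hA]
    | succ k ih => rw [hrun.step_x, map_add, map_smul, map_P, smul_zero, add_zero, ih]
  have hα : ∀ k, α k = alpha f S ebar fhat (x k) (fstar f S A b) := by
    rintro (_ | k)
    · exact hrun.init_alpha
    · exact hrun.step_alpha k
  obtain ⟨h1, h2, h3, h4, h5⟩ := alpha_spec hf_lsc hf_conv hS_closed hS_conv he hA hep hfs hlt
    (hAx k)
  rw [← hα k] at h1 h2 h3 h4 h5
  have heq : x' k = lineX ebar (x k) (α k) ∧ t' k = lineT fhat (fstar f S A b) (α k) := by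
    cases k with
    | zero =>
      -- The ray from (ē, f̂) is vertical, so the prescribed start (ē, f(ē)) is its radial
      -- projection: maximality of α, tested where the ray has height f(ē), gives t(α) ≤ f(ē).
      have hX : ∀ a, lineX ebar (x 0) a = ebar := fun a => by simp [lineX, hrun.init_x]
      refine ⟨by rw [hX, hrun.init_proj.1], ?_⟩
      rw [hrun.init_proj.2]
      rw [hX] at h4
      have hetop : f ebar ≠ ⊤ := mem_dom_of_le_coe h4
      apply le_antisymm
      · rwa [← EReal.coe_le_coe_iff, EReal.coe_toReal hetop (hf_bot _)]
      · have hd : 0 < fhat - fstar f S A b := sub_pos.2 hlt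
        have hc := h5 ((fhat - (f ebar).toReal) / (fhat - fstar f S A b))
        have hT : lineT fhat (fstar f S A b)
            ((fhat - (f ebar).toReal) / (fhat - fstar f S A b)) = (f ebar).toReal := by
          unfold lineT
          field_simp
          ring
        rw [hX, hT] at hc
        have hc := hc (interior_subset he) (EReal.le_coe_toReal hetop)
        rw [div_le_iff₀ hd] at hc
        unfold lineT
        linarith
    | succ k =>
      have h := hrun.step_proj k
      rw [radialProj, ← hα] at h
      simpa [Prod.ext_iff, lineX, lineT] using h
  refine ⟨hAx k, h1, h2, ?_, ?_, heq⟩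
  · rw [heq.1]
    exact h3
  · rw [heq.1, heq.2]
    exact h4

end Run

/-- The optimality gap of a run in terms of `α`. -/
lemma gap_le {X : Type*} {f : X → EReal} (hf_bot : ∀ x, f x ≠ ⊥) {fhat fs a t : ℝ}
    (hlt : fs < fhat) {y : X} (hy : f y ≤ t) (ht : t = lineT fhat fs a) : ((f y).toReal - fs) / (fhat - fs) ≤ 1 - a := by
  rw [div_le_iff₀ (sub_pos.2 hlt)]
  have h := EReal.toReal_le_toReal hy (hf_bot y) (EReal.coe_ne_top t)
  rw [EReal.toReal_coe, ht, lineT] at h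
  linarith

end AlgorithmB

/-! ### The iteration bound -/

theorem theorem1p2
    {E : Type*} [NormedAddCommGroup E] [InnerProductSpace ℝ E] [FiniteDimensional ℝ E]
    {F : Type*} [AddCommGroup F] [Module ℝ F]
    (f : E → EReal) (hf_bot : ∀ x, f x ≠ ⊥) (hf_lsc : LowerSemicontinuous f)
    (hf_conv : Convex ℝ (AlgorithmB.epi f))
    (S : Set E) (hS_closed : IsClosed S) (hS_conv : Convex ℝ S)
    (A : E →ₗ[ℝ] F) (b : F)
    (ebar : E) (hebar : ebar ∈ interior (S ∩ AlgorithmB.dom f)) (hA : A ebar = b)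
    (hbdd : Bornology.IsBounded (AlgorithmB.sublevel f S A b ebar))
    (fhat : ℝ) (hfhat : f ebar < (fhat : EReal))
    (x x' : ℕ → E) (t' α : ℕ → ℝ) (g : ℕ → E)
    (hrun : AlgorithmB.IsRun f S A b ebar fhat x x' t' α g) :
    (∀ k, x' k ∈ AlgorithmB.feas S A b ∧ x' k ∈ AlgorithmB.dom f) ∧
    ∀ ε : ℝ, 0 < ε → ε < 1 → ∀ l : ℕ,
      4 * (AlgorithmB.Dbar f S A b ebar / AlgorithmB.rhat f S A b ebar fhat) ^ 2 *
          (4 / 3 * ((1 - ε) / ε) ^ 2 + 4 * ((1 - ε) / ε) + Real.logb 2 ((1 - ε) / ε) +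
            Real.logb 2 (AlgorithmB.Dbar f S A b ebar / AlgorithmB.rhat f S A b ebar fhat) + 1)
        ≤ (l : ℝ) →
      ∃ k ≤ l,
        ((f (x' k)).toReal - AlgorithmB.fstar f S A b) / (fhat - AlgorithmB.fstar f S A b) ≤ ε :=
  by
  open AlgorithmB in
  have heS : ebar ∈ interior S := interior_mono Set.inter_subset_left hebar
  have hed : ebar ∈ interior (dom f) := interior_mono Set.inter_subset_right hebar
  have hep := mem_interior_epi hf_bot hf_conv hed hfhat
  obtain ⟨z, hz, hfz, hfs⟩ := exists_minimizer hf_bot hf_lsc hS_closed (interior_subset heS)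
    (interior_subset hed) hA hbdd
  have hlt : fstar f S A b < fhat := by
    rw [← EReal.coe_lt_coe_iff, ← hfz]
    exact hz.2.trans_lt hfhat
  have hinv := hrun.invariants hf_bot hf_lsc hf_conv hS_closed hS_conv heS hA hep hfs hlt
  refine ⟨fun k => ?_, fun ε hε0 hε1 l hl => ?_⟩
  · obtain ⟨hAx, -, -, hS, hf, hx', -⟩ := hinv k
    refine ⟨⟨hS, ?_⟩, mem_dom_of_le_coe hf⟩
    simp [hx', lineX, hAx, hA]
  set R : Set ℝ := {r : ℝ | ∀ x : E, ‖x - ebar‖ ≤ r → A x = b → x ∈ S ∧ f x ≤ (fhat : EReal)}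
    with hR
  set d : ℕ → ℝ := fun k => (1 - α k) / α k with hd
  have hd0 : ∀ k, 0 ≤ d k := fun k =>
    div_nonneg (sub_nonneg.2 (hinv k).2.2.1) (hinv k).2.1.le
  -- the subgradient inequality and the norm bound
  have hsub : ∀ k, d k ≤ ⟪P A (g k), x k - z⟫ ∧ ∀ r ∈ R, 0 ≤ r → r * ‖P A (g k)‖ ≤ 1 := by
    intro k
    obtain ⟨hAx, hα0, -, -, -, hx', ht'⟩ := hinv k
    obtain ⟨δ, hle, heq⟩ := exists_support_of_mem_G heS hep (hrun.choose_g k)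
    refine ⟨?_, fun r hr hr0 => mul_norm_P_le_one A _ hr0 fun u hu hAu => ?_⟩
    · rw [inner_P_of_map_eq_zero A _ (by rw [map_sub, hAx, hz.1.2, sub_self])]
      have h1 := hle z hz.1.1 _ hfz.le
      simp only [hx', ht', lineX, lineT, add_sub_cancel_left, inner_smul_right] at heq
      -- Dividing the normalization at (x', t') by α moves it to (x, f*).
      have h2 : ⟪g k, x k - ebar⟫ + δ * (fstar f S A b - fhat) = 1 / α k := by
        rw [eq_div_iff hα0.ne']
        linarith
      have h3 : ⟪g k, x k - z⟫ = ⟪g k, x k - ebar⟫ - ⟪g k, z - ebar⟫ := by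
        rw [← inner_sub_right, sub_sub_sub_cancel_right]
      have h4 : d k = 1 / α k - 1 := by
        simp only [hd]
        field_simp
      linarith
    -- At height f̂ the δ term vanishes.
    · obtain ⟨h1, h2⟩ := hr (ebar + u) (by simpa using hu) (by simp [hA, hAu])
      simpa using hle _ h1 fhat h2
  have hstep : ∀ r, 0 ≤ r → (∀ k, r * ‖P A (g k)‖ ≤ 1) → ∀ k,
      ‖x (k + 1) - z‖ ^ 2 + (r * d k) ^ 2 ≤ ‖x k - z‖ ^ 2 := by
    intro r hr0 hr k
    have h := norm_polyak_step_sq_le (hd0 k) hr0 (hr k) (hsub k).1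
    have hα0 := (hinv k).2.1
    have hx : x (k + 1) - z = x k - z + (-d k / ‖P A (g k)‖ ^ 2) • P A (g k) := by
      rw [hrun.step_x, add_sub_right_comm]
      congr 2
      simp only [hd]
      rw [← neg_div, neg_sub, div_div]
    rwa [hx]
  have hinit : ∀ r, 0 ≤ r → (∀ k, r * ‖P A (g k)‖ ≤ 1) → r * d 0 ≤ ‖ebar - z‖ := by
    intro r hr0 hr
    have h := hstep r hr0 hr 0
    rw [hrun.init_x] at h
    exact le_of_sq_le_sq (by nlinarith [sq_nonneg ‖x (0 + 1) - z‖]) (norm_nonneg _)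
  -- The premise says exactly α ≥ 1 - ε.
  have hdone : ∀ k, d k * ((1 - ε) / ε) ≤ 1 →
      ((f (x' k)).toReal - fstar f S A b) / (fhat - fstar f S A b) ≤ ε := by
    intro k hk
    obtain ⟨-, hα0, -, -, hf, -, ht'⟩ := hinv k
    refine (gap_le hf_bot hlt hf ht').trans ?_
    simp only [hd] at hk
    rw [div_mul_div_comm, div_le_one (by positivity)] at hk
    nlinarith
  have hs : 0 < (1 - ε) / ε := div_pos (by linarith) hε0
  obtain ⟨r₀, hr₀, hr₀R⟩ : ∃ r₀ > 0, r₀ ∈ R := by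
    obtain ⟨r, hr, hball⟩ := Metric.nhds_basis_closedBall.mem_iff.1
      (Filter.inter_mem (mem_interior_iff_mem_nhds.1 heS)
        (eventually_lt_of_mem_interior_dom hf_bot hf_conv hed hfhat))
    exact ⟨r, hr, fun y hy _ =>
      have h := hball (by rwa [Metric.mem_closedBall, dist_eq_norm])
      ⟨h.1, le_of_lt h.2⟩⟩
  -- `sSup` of an unbounded set of reals is 0, so that case is settled without r̂.
  by_cases hRb : BddAbove R
  swap
  · -- every radius is admissible, so `ebar` is optimal
    refine ⟨0, Nat.zero_le _, hdone 0 ?_⟩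
    suffices d 0 = 0 by simp [this]
    by_contra hne
    have hpos : 0 < d 0 := (hd0 0).lt_of_ne' hne
    obtain ⟨r, hr, hrlt⟩ := not_bddAbove_iff.1 hRb ((‖ebar - z‖ + 1) / d 0)
    rw [div_lt_iff₀ hpos] at hrlt
    have h0 : 0 ≤ r := by
      by_contra! h
      nlinarith [norm_nonneg (ebar - z)]
    linarith [hinit r h0 fun k => (hsub k).2 r hr h0]
  have hrhat : rhat f S A b ebar fhat = sSup R := rfl
  have hr : 0 < sSup R := hr₀.trans_le (le_csSup hRb hr₀R)
  have hnorm : ∀ k, sSup R * ‖P A (g k)‖ ≤ 1 := by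
    intro k
    rcases (norm_nonneg (P A (g k))).eq_or_lt with h0 | h0
    · simp [← h0]
    rw [← le_div_iff₀ h0]
    refine csSup_le ⟨r₀, hr₀R⟩ fun r hr => ?_
    rcases le_total 0 r with hr0 | hr0
    · rw [le_div_iff₀ h0]
      exact (hsub k).2 r hr hr0
    · exact hr0.trans (by positivity)
  have hD : ‖ebar - z‖ ≤ Dbar f S A b ebar := by
    rw [← dist_eq_norm]
    exact Metric.dist_le_diam_of_mem hbdd ⟨⟨interior_subset heS, hA⟩, le_rfl⟩ hz
  have hD0 : 0 ≤ Dbar f S A b ebar := (norm_nonneg _).trans hD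
  rw [hrhat] at hl
  set D := Dbar f S A b ebar with hDdef
  set r := sSup R with hrdef
  set s := (1 - ε) / ε with hsdef
  -- Here the logarithms may be negative, but the starting point already suffices, since r d₀ ≤ ‖ē -
  -- z‖ ≤ D.
  by_cases hρs : D / r * s ≤ 1
  · refine ⟨0, Nat.zero_le _, hdone 0 (le_trans ?_ hρs)⟩
    refine mul_le_mul_of_nonneg_right ?_ hs.le
    rw [le_div_iff₀ hr, mul_comm]
    exact (hinit r hr.le hnorm).trans hD
  by_contra! hcon
  have hbig : ∀ k ≤ l, 1 / s ≤ d k := by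
    intro k hk
    by_contra! h
    rw [lt_div_iff₀ hs] at h
    exact absurd (hdone k h.le) (not_le.2 (hcon k hk))
  -- Iterations 0 to l give l + 1 decreases; the extra one makes the final contradiction strict.
  have hsum : ∀ k ≤ l + 1, ‖x k - z‖ ^ 2 + k * (r / s) ^ 2 ≤ D ^ 2 := by
    intro k
    induction k with
    | zero =>
      intro _
      rw [hrun.init_x]
      simpa using pow_le_pow_left₀ (norm_nonneg _) hD 2
    | succ k ih =>
      intro hk
      have h1 := ih (by omega)
      have h2 := hstep r hr.le hnorm k
      have h3 : (r / s) ^ 2 ≤ (r * d k) ^ 2 := by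
        rw [div_eq_mul_one_div]
        gcongr
        exact hbig k (by omega)
      push_cast
      linarith
  have h1 := hsum (l + 1) le_rfl
  push_cast at h1
  have h2 : (l + 1 : ℝ) ≤ (D / r) ^ 2 * s ^ 2 := by
    have h3 : ((l : ℝ) + 1) * (r / s) ^ 2 ≤ D ^ 2 := by linarith [sq_nonneg ‖x (l + 1) - z‖]
    calc (l + 1 : ℝ) = (l + 1) * (r / s) ^ 2 * (s / r) ^ 2 := by field_simp
      _ ≤ D ^ 2 * (s / r) ^ 2 := by gcongr
      _ = (D / r) ^ 2 * s ^ 2 := by ring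
  have hlog : 0 ≤ Real.logb 2 s + Real.logb 2 (D / r) := by
    have hρ : D / r ≠ 0 := by
      intro h
      simp [h] at hρs
    rw [← Real.logb_mul hs.ne' hρ]
    exact Real.logb_nonneg (by norm_num) (by linarith)
  -- A quarter of s² in the bracket is enough; every other term is nonnegative in this case.
  have h4 : 4 * (D / r) ^ 2 * (s ^ 2 / 4) ≤ 4 * (D / r) ^ 2 *
      (4 / 3 * s ^ 2 + 4 * s + Real.logb 2 s + Real.logb 2 (D / r) + 1) := by
    gcongr
    nlinarith [sq_nonneg s]
  linarith
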